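/- For a Lebesgue measurable set $\Omega\subset\mathbb R$ with $0<|\Omega|<\infty$ and a set $\Lambda\subset\mathbb R$, call $(\Omega,\Lambda)$ a spectral pair (and $\Lambda$ a spectrum of $\Omega$) if the functions $e_\lambda(x)=|\Omega|^{-1/2}e^{2\pi i\lambda x}\chi_\Omega(x)$, $\lambda\in\Lambda$, form an orthonormal basis of $L^2(\Omega)$. For $d>0$, call $\Lambda$ $d$-periodic if $\Lambda=\{\gamma_1,\dots,\gamma_m\}+d\mathbb Z$ for some finite set $\{\gamma_1,\dots,\gamma_m\}\subset\mathbb R$. Let $d>0$ be real and let $(\Omega,\Lambda)$ be a spectral pair such that $\Omega$ is bounded and $\Lambda$ is $d$-periodic. Then there are a partition of $[0,1/d)$ into finitely many pairwise disjoint Lebesgue measurable sets $E_1,\dots,E_k$ of positive measure, and sets $A_1,\dots,A_k\subseteq\frac1d\mathbb Z$, such that $$\Omega=\bigcup_{j=1}^k(E_j+A_j)$$ up to a set of Lebesgue measure zero, with exact equality if $\Omega$ is a finite union of half-open intervals $[a,b)$. Moreover, for every $j$ the set $\Omega_j:=[0,1/d)+A_j$ is a spectral set with spectrum $\Lambda$,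 i.e. $(\Omega_j,\Lambda)$ is a spectral pair. -/

import Mathlib

open MeasureTheory Set
open scoped Pointwise

/-- The normalized exponential `x ↦ |Ω|^(-1/2) e^{2 π i l x} χ_Ω(x)` of frequency `l`. -/
noncomputable def expOn (Ω : Set ℝ) (l : ℝ) : ℝ → ℂ :=
  Ω.indicator fun x =>
    (((volume Ω).toReal ^ (-(1 / 2) : ℝ) : ℝ) : ℂ) * Complex.exp (2 * Real.pi * Complex.I * l * x)

/-- `(Ω, Λ)` is a spectral pair: `Ω` is Lebesgue measurable of finite positive measure, and the
functions `expOn Ω l`, `l ∈ Λ`, form an orthonormal (Hilbert) basis of `L²(Ω)`. -/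
structure IsSpectralPair (Ω Λ : Set ℝ) : Prop where
  nullMeasurableSet : NullMeasurableSet Ω volume
  volume_pos : 0 < volume Ω
  volume_lt_top : volume Ω < ⊤
  exists_basis : ∃ b : HilbertBasis Λ ℂ (Lp ℂ 2 (volume.restrict Ω)),
    ∀ l : Λ, (b l : ℝ → ℂ) =ᵐ[volume.restrict Ω] expOn Ω (l : ℝ)

/-- The set `Λ` is `d`-periodic: `Λ = {γ₁, …, γₘ} + d ℤ`. -/
def IsPeriodicSet (d : ℝ) (Λ : Set ℝ) : Prop :=
  ∃ Γ : Finset ℝ, Λ = (Γ : Set ℝ) + range fun n : ℤ => d * (n : ℝ)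

/-- `Ω` is a finite union of half-open intervals `[a, b)`. -/
def IsHalfOpenUnion (Ω : Set ℝ) : Prop :=
  ∃ (n : ℕ) (a b : Fin n → ℝ), Ω = ⋃ i, Ico (a i) (b i)

/-! The line is folded onto the cell `[0, 1/d)`: over `x` lies the `fiber` of integers `k` with `x +
k/d ∈ Ω`. Since `Λ + dℤ = Λ`, each spectral condition at a frequency `l` comes with those at all `l
+ n d`. The characters of frequency `n d` are constant on fibers, so after folding these conditions
say that every Fourier coefficient of one function on the cell vanishes. Hence a fiber sum is zero
for almost every `x` (`sum_fiber_ae_eq_zero`). A global spectral condition thus becomes a condition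
on finite sets of integers, `IsFiberSpectrum`. Every fiber `B` occurring on a set of positive
measure satisfies it (`IsSpectralPair.isFiberSpectrum`). Conversely, it makes `[0, 1/d) + B/d`, all
of whose fibers equal `B`, a spectral set (`IsFiberSpectrum.isSpectralPair`). The `E_j` are the
level sets of the fiber map, and the `A_j` are the fibers divided by `d`. Boundedness of `Ω` leaves
only finitely many possible fibers. -/

/-- The character `t ↦ e^{2 π i t}` of the real line. -/
noncomputable def planeWave (t : ℝ) : ℂ := Complex.exp (2 * Real.pi * Complex.I * t)

theorem planeWave_add (s t : ℝ) : planeWave (s + t) = planeWave s * planeWave t := by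
  simp only [planeWave, ← Complex.exp_add]
  push_cast
  ring_nf

@[simp]
theorem planeWave_zero : planeWave 0 = 1 := by simp [planeWave]

@[simp]
theorem planeWave_intCast (n : ℤ) : planeWave n = 1 := by
  rw [planeWave, Complex.exp_eq_one_iff]
  exact ⟨n, by push_cast; ring⟩

@[simp]
theorem norm_planeWave (t : ℝ) : ‖planeWave t‖ = 1 := by
  have := Complex.norm_exp_ofReal_mul_I (2 * Real.pi * t)
  rw [planeWave, ← this]
  congr 2
  push_cast
  ring

theorem planeWave_ne_zero (t : ℝ) : planeWave t ≠ 0 := Complex.exp_ne_zero _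

theorem conj_planeWave (t : ℝ) : (starRingEnd ℂ) (planeWave t) = planeWave (-t) := by
  simp [planeWave, ← Complex.exp_conj, Complex.conj_ofNat]

@[fun_prop]
theorem continuous_planeWave : Continuous planeWave := by
  unfold planeWave
  fun_prop

/-! ### Fourier uniqueness on the cell -/

/-- An `L²` function on `[0, 1/d)` all of whose Fourier coefficients vanish is zero. -/
theorem ae_eq_zero_of_fourier_eq_zero {d : ℝ} (hd : 0 < d) {h : ℝ → ℂ}
    (hh : MemLp h 2 (volume.restrict (Ico 0 (1 / d))))
    (h0 : ∀ n : ℤ, ∫ x in Ico 0 (1 / d), planeWave (n * d * x) * h x = 0) :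
    h =ᵐ[volume.restrict (Ico 0 (1 / d))] 0 := by
  have : Fact (0 < 1 / d) := ⟨by positivity⟩
  have hr : (volume : Measure ℝ).restrict (Ico 0 (1 / d)) = volume.restrict (Ioc 0 (1 / d)) :=
    Measure.restrict_congr_set Ico_ae_eq_Ioc
  rw [hr] at hh ⊢
  simp only [hr] at h0
  have hL : MemLp (AddCircle.liftIoc (1 / d) 0 h) 2 AddCircle.haarAddCircle := by
    have := MemLp.memLp_liftIoc (T := 1 / d) (t := 0) (f := h) (p := 2) (by simpa using hh)
    -- The circle of length `1/d` has mass `1/d`; the factor `d` turns its volume into the Haar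
    -- probability measure.
    have h2 := this.smul_measure (c := ENNReal.ofReal d) ENNReal.ofReal_ne_top
    rwa [AddCircle.volume_eq_smul_haarAddCircle, smul_smul, ← ENNReal.ofReal_mul hd.le,
      mul_one_div_cancel hd.ne', ENNReal.ofReal_one, one_smul] at h2
  have hc : ∀ n : ℤ, fourierCoeff (AddCircle.liftIoc (1 / d) 0 h) n = 0 := by
    intro n
    rw [fourierCoeff_liftIoc_eq, fourierCoeffOn_eq_integral,
      intervalIntegral.integral_of_le (by simpa using hd.le)]
    have : ∀ x : ℝ, (fourier (-n) (x : AddCircle (0 + 1 / d - 0)) : ℂ) • h x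
        = planeWave ((-n : ℤ) * d * x) * h x := by
      intro x
      rw [fourier_coe_apply, smul_eq_mul, planeWave]
      congr 2
      push_cast
      simp
      ring
    simp only [this]
    rw [zero_add, h0, smul_zero]
  have hz : hL.toLp _ = 0 := by
    apply fourierBasis.repr.injective
    ext n
    rw [fourierBasis_repr, ← fourierCoeff_congr_ae hL.coeFn_toLp.symm, hc]
    simp
  have hae : AddCircle.liftIoc (1 / d) 0 h =ᵐ[volume] 0 := by
    rw [AddCircle.volume_eq_smul_haarAddCircle]
    apply Measure.ae_smul_measure
    exact (hL.coeFn_toLp.symm.trans (by rw [hz])).trans (Lp.coeFn_zero _ _ _)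
  have := (AddCircle.measurePreserving_mk (1 / d) 0).quasiMeasurePreserving.ae_eq_comp hae
  rw [zero_add] at this
  filter_upwards [this, ae_restrict_mem measurableSet_Ioc] with x hx hx'
  rw [← AddCircle.liftIoc_zero_coe_apply (f := h) hx']
  exact hx

/-! ### Spectral pairs as orthogonality plus totality -/

theorem memLp_indicator_of_nullMeasurableSet {S : Set ℝ} (hS : NullMeasurableSet S volume)
    {f : ℝ → ℂ} (hf : MemLp f 2 (volume.restrict S)) : MemLp (S.indicator f) 2 volume := by
  rw [← memLp_congr_ae (indicator_ae_eq_of_ae_eq_set hS.toMeasurable_ae_eq),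
    memLp_indicator_iff_restrict (measurableSet_toMeasurable _ _),
    Measure.restrict_congr_set hS.toMeasurable_ae_eq]
  exact hf

theorem expOn_eq (Ω : Set ℝ) (l : ℝ) : expOn Ω l = Ω.indicator fun x =>
    (((volume Ω).toReal ^ (-(1 / 2) : ℝ) : ℝ) : ℂ) * planeWave (l * x) := by
  unfold expOn planeWave
  congr 1
  ext x
  congr 2
  push_cast
  ring

theorem expOn_ae_eq {Ω : Set ℝ} (hΩ : NullMeasurableSet Ω volume) (l : ℝ) :
    expOn Ω l =ᵐ[volume.restrict Ω] fun x =>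
      (((volume Ω).toReal ^ (-(1 / 2) : ℝ) : ℝ) : ℂ) * planeWave (l * x) := by
  filter_upwards [ae_restrict_mem₀ hΩ] with x hx
  rw [expOn_eq, indicator_of_mem hx]

theorem memLp_mul_planeWave {μ : Measure ℝ} [IsFiniteMeasure μ] (c : ℂ) (l : ℝ) :
    MemLp (fun x => c * planeWave (l * x)) 2 μ := by
  refine MemLp.of_bound (by fun_prop) ‖c‖ (ae_of_all _ fun x => ?_)
  simp

theorem memLp_expOn {Ω : Set ℝ} (hΩ : NullMeasurableSet Ω volume) (hfin : volume Ω < ⊤) (l : ℝ) :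
    MemLp (expOn Ω l) 2 (volume.restrict Ω) := by
  have : IsFiniteMeasure (volume.restrict Ω) := ⟨by simpa using hfin⟩
  rw [memLp_congr_ae (expOn_ae_eq hΩ l)]
  exact memLp_mul_planeWave _ _

theorem inner_expOn {Ω : Set ℝ} (hΩ : NullMeasurableSet Ω volume) (l : ℝ)
    (u f : Lp ℂ 2 (volume.restrict Ω)) (hu : (u : ℝ → ℂ) =ᵐ[volume.restrict Ω] expOn Ω l) :
    inner ℂ u f = (((volume Ω).toReal ^ (-(1 / 2) : ℝ) : ℝ) : ℂ) *
      ∫ x in Ω, planeWave (-(l * x)) * f x := by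
  rw [L2.inner_def, ← integral_const_mul]
  refine integral_congr_ae ?_
  filter_upwards [hu, expOn_ae_eq hΩ l] with x h1 h2
  rw [h1, h2, RCLike.inner_apply', map_mul, conj_planeWave, Complex.conj_ofReal]
  ring

theorem inner_expOn_expOn {Ω : Set ℝ} (hΩ : NullMeasurableSet Ω volume) (hpos : 0 < volume Ω)
    (hfin : volume Ω < ⊤) (l m : ℝ) (u v : Lp ℂ 2 (volume.restrict Ω))
    (hu : (u : ℝ → ℂ) =ᵐ[volume.restrict Ω] expOn Ω l)
    (hv : (v : ℝ → ℂ) =ᵐ[volume.restrict Ω] expOn Ω m) :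
    inner ℂ u v = (((volume Ω).toReal⁻¹ : ℝ) : ℂ) * ∫ x in Ω, planeWave ((m - l) * x) := by
  have hp : 0 < (volume Ω).toReal := ENNReal.toReal_pos hpos.ne' hfin.ne
  rw [inner_expOn hΩ l u v hu, ← Real.rpow_neg_one,
    show (-1 : ℝ) = -(1 / 2) + -(1 / 2) by norm_num, Real.rpow_add hp, Complex.ofReal_mul, mul_assoc]
  congr 1
  rw [← integral_const_mul]
  refine integral_congr_ae ?_
  filter_upwards [hv, expOn_ae_eq hΩ m] with x h1 h2
  rw [h1, h2, show (m - l) * x = -(l * x) + m * x by ring, planeWave_add]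
  ring

/-- An orthonormal family is a Hilbert basis exactly when its orthogonal complement is trivial. The
normalizing constants are nonzero and drop out, leaving integrals that can be folded. -/
theorem isSpectralPair_iff {Ω Λ : Set ℝ} : IsSpectralPair Ω Λ ↔
    NullMeasurableSet Ω volume ∧ 0 < volume Ω ∧ volume Ω < ⊤ ∧
    (∀ l ∈ Λ, ∀ m ∈ Λ, l ≠ m → ∫ x in Ω, planeWave ((m - l) * x) = 0) ∧
    ∀ f : ℝ → ℂ, MemLp f 2 (volume.restrict Ω) →
      (∀ l ∈ Λ, ∫ x in Ω, planeWave (-(l * x)) * f x = 0) → f =ᵐ[volume.restrict Ω] 0 := by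
  constructor
  · rintro ⟨hΩ, hpos, hfin, b, hb⟩
    have hp : 0 < (volume Ω).toReal := ENNReal.toReal_pos hpos.ne' hfin.ne
    refine ⟨hΩ, hpos, hfin, fun l hl m hm hlm => ?_, fun f hf h0 => ?_⟩
    · have h := b.orthonormal.2 (i := ⟨l, hl⟩) (j := ⟨m, hm⟩) (by simpa using hlm)
      change inner ℂ (b ⟨l, hl⟩) (b ⟨m, hm⟩) = 0 at h
      rw [inner_expOn_expOn hΩ hpos hfin l m _ _ (hb ⟨l, hl⟩) (hb ⟨m, hm⟩)] at h
      refine (mul_eq_zero.1 h).resolve_left ?_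
      exact_mod_cast (inv_pos.2 hp).ne'
    · have hz : hf.toLp f = 0 := by
        apply b.repr.injective
        ext l
        rw [b.repr_apply_apply, inner_expOn hΩ l _ _ (hb l)]
        have : ∫ x in Ω, planeWave (-(l * x)) * hf.toLp f x = 0 := by
          rw [← h0 l l.2]
          refine integral_congr_ae ?_
          filter_upwards [hf.coeFn_toLp] with x hx
          rw [hx]
        simp [this]
      exact (hf.coeFn_toLp.symm.trans (by rw [hz])).trans (Lp.coeFn_zero _ _ _)
  · rintro ⟨hΩ, hpos, hfin, horth, hcomp⟩
    have hp : 0 < (volume Ω).toReal := ENNReal.toReal_pos hpos.ne' hfin.ne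
    let v : Λ → Lp ℂ 2 (volume.restrict Ω) := fun l => (memLp_expOn hΩ hfin (l : ℝ)).toLp _
    have hv : ∀ l : Λ, (v l : ℝ → ℂ) =ᵐ[volume.restrict Ω] expOn Ω (l : ℝ) :=
      fun l => MemLp.coeFn_toLp _
    have ho : Orthonormal ℂ v := by
      classical
      rw [orthonormal_iff_ite]
      intro l m
      rw [inner_expOn_expOn hΩ hpos hfin l m _ _ (hv l) (hv m)]
      split_ifs with h
      · subst h
        simp only [sub_self, zero_mul, planeWave_zero, integral_const,
          Complex.real_smul, mul_one, Measure.real, Measure.restrict_apply_univ]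
        rw [← Complex.ofReal_mul, inv_mul_cancel₀ hp.ne', Complex.ofReal_one]
      · rw [horth l l.2 m m.2 (by simpa [Subtype.ext_iff] using h), mul_zero]
    refine ⟨hΩ, hpos, hfin, HilbertBasis.mkOfOrthogonalEqBot ho ?_, fun l => ?_⟩
    · rw [Submodule.eq_bot_iff]
      intro f hf
      rw [Submodule.mem_orthogonal] at hf
      rw [Lp.eq_zero_iff_ae_eq_zero]
      refine hcomp f (Lp.memLp f) fun l hl => ?_
      have := hf (v ⟨l, hl⟩) (Submodule.subset_span ⟨_, rfl⟩)
      rw [inner_expOn hΩ l _ _ (hv ⟨l, hl⟩)] at this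
      refine (mul_eq_zero.1 this).resolve_left ?_
      exact_mod_cast (Real.rpow_pos_of_pos hp _).ne'
    · rw [HilbertBasis.coe_mkOfOrthogonalEqBot]
      exact hv l

/-! ### Folding onto the cell -/

/-- The points `k / d` with `k ∈ K`. -/
noncomputable def latticePoints (d : ℝ) (K : Finset ℤ) : Set ℝ := (fun k : ℤ => (k : ℝ) / d) '' K

/-- The set of `k ∈ K` with `x + k / d ∈ Ω`. -/
noncomputable def fiber (d : ℝ) (K : Finset ℤ) (Ω : Set ℝ) (x : ℝ) : Finset ℤ :=
  open scoped Classical in K.filter fun k => x + (k : ℝ) / d ∈ Ω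

theorem mem_fiber {d : ℝ} {K : Finset ℤ} {Ω : Set ℝ} {x : ℝ} {k : ℤ} :
    k ∈ fiber d K Ω x ↔ k ∈ K ∧ x + (k : ℝ) / d ∈ Ω := by
  simp [fiber]

theorem add_latticePoints_eq {d : ℝ} (E : Set ℝ) (K : Finset ℤ) :
    E + latticePoints d K = ⋃ k ∈ K, (fun x => x - (k : ℝ) / d) ⁻¹' E := by
  ext y
  simp only [latticePoints, mem_add, mem_image, Finset.mem_coe, mem_iUnion, mem_preimage]
  constructor
  · rintro ⟨x, hx, _, ⟨k, hk, rfl⟩, rfl⟩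
    exact ⟨k, hk, by simpa using hx⟩
  · rintro ⟨k, hk, h⟩
    exact ⟨_, h, _, ⟨k, hk, rfl⟩, by ring⟩

/-- After scaling by `d`, both points lie in `[0, 1)`, so `k - j` is an integer of absolute value
below `1`. This makes the lattice translates of the cell disjoint. -/
theorem int_eq_of_mem_Ico {d : ℝ} (hd : 0 < d) {x y : ℝ} (hx : x ∈ Ico 0 (1 / d))
    (hy : y ∈ Ico 0 (1 / d)) {k j : ℤ} (h : x + k / d = y + j / d) : k = j := by
  have hx1 := (lt_div_iff₀ hd).1 hx.2
  have hy1 := (lt_div_iff₀ hd).1 hy.2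
  have hx0 := mul_nonneg hx.1 hd.le
  have hy0 := mul_nonneg hy.1 hd.le
  have h2 : x * d + k = y * d + j := by
    field_simp at h
    linarith
  have h3 : ((k - j : ℤ) : ℝ) < 1 := by push_cast; linarith
  have h4 : ((j - k : ℤ) : ℝ) < 1 := by push_cast; linarith
  have h5 : k - j < 1 := by exact_mod_cast h3
  have h6 : j - k < 1 := by exact_mod_cast h4
  omega

theorem mem_add_latticePoints {d : ℝ} (hd : 0 < d) {E : Set ℝ} (hE : E ⊆ Ico 0 (1 / d))
    {K : Finset ℤ} {x : ℝ} (hx : x ∈ Ico 0 (1 / d)) {k : ℤ} :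
    x + (k : ℝ) / d ∈ E + latticePoints d K ↔ x ∈ E ∧ k ∈ K := by
  simp only [latticePoints, mem_add, mem_image, Finset.mem_coe]
  constructor
  · rintro ⟨y, hy, _, ⟨j, hj, rfl⟩, h⟩
    obtain rfl := int_eq_of_mem_Ico hd (hE hy) hx h
    obtain rfl : y = x := by linarith
    exact ⟨hy, hj⟩
  · rintro ⟨h1, h2⟩
    exact ⟨x, h1, _, ⟨k, h2, rfl⟩, rfl⟩

theorem nullMeasurableSet_preimage_add {S : Set ℝ} (hS : NullMeasurableSet S volume) (c : ℝ) :
    NullMeasurableSet ((fun x => x + c) ⁻¹' S) volume :=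
  hS.preimage (measurePreserving_add_right volume c).quasiMeasurePreserving

theorem nullMeasurableSet_add_latticePoints {d : ℝ} {E : Set ℝ} (hE : NullMeasurableSet E volume)
    (K : Finset ℤ) : NullMeasurableSet (E + latticePoints d K) volume := by
  rw [add_latticePoints_eq]
  refine Finset.nullMeasurableSet_biUnion _ fun k _ => ?_
  simpa [sub_eq_add_neg] using nullMeasurableSet_preimage_add hE (-((k : ℝ) / d))

theorem integral_eq_integral_sum_fiber {d : ℝ} (hd : 0 < d) {S : Set ℝ} {K : Finset ℤ}
    (hS : NullMeasurableSet S volume) (hSK : S ⊆ Ico 0 (1 / d) + latticePoints d K) {g : ℝ → ℂ}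
    (hg : Integrable (S.indicator g) volume) :
    ∫ x in S, g x = ∫ x in Ico 0 (1 / d), ∑ k ∈ K, S.indicator g (x + (k : ℝ) / d) := by
  have hmp : ∀ c : ℝ, MeasurePreserving (fun x : ℝ => x + c) volume volume :=
    fun c => measurePreserving_add_right volume c
  have hpre : ∀ k : ℤ, (fun x => x + (k : ℝ) / d) ⁻¹' ((fun x => x - (k : ℝ) / d) ⁻¹' Ico 0 (1 / d))
      = Ico 0 (1 / d) := by
    intro k
    ext x
    simp
  have hme : ∀ k : ℤ, MeasurableSet ((fun x => x - (k : ℝ) / d) ⁻¹' Ico 0 (1 / d)) :=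
    fun k => (measurable_sub_const _) measurableSet_Ico
  rw [integral_finsetSum]
  · rw [← integral_indicator₀ hS,
      ← setIntegral_eq_integral_of_forall_compl_eq_zero
        (s := ⋃ k ∈ K, (fun x => x - (k : ℝ) / d) ⁻¹' Ico 0 (1 / d)),
      integral_biUnion_finset]
    · refine Finset.sum_congr rfl fun k _ => ?_
      rw [← (hmp ((k : ℝ) / d)).setIntegral_preimage_emb (measurableEmbedding_addRight _), hpre]
    · exact fun k _ => hme k
    · intro k _ j _ hkj
      refine Set.disjoint_left.2 fun y hy hy' => hkj ?_
      exact int_eq_of_mem_Ico hd hy hy' (by ring)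
    · exact fun k _ => hg.integrableOn
    · intro x hx
      refine indicator_of_notMem (fun h => hx ?_) _
      rw [← add_latticePoints_eq]
      exact hSK h
  · exact fun k _ => ((hmp _).integrable_comp_of_integrable hg).integrableOn

theorem sum_indicator_eq_sum_fiber {d : ℝ} {K : Finset ℤ} {Ω : Set ℝ} (g : ℝ → ℂ) (x : ℝ) :
    ∑ k ∈ K, Ω.indicator g (x + (k : ℝ) / d) = ∑ k ∈ fiber d K Ω x, g (x + (k : ℝ) / d) := by
  classical
  rw [fiber, Finset.sum_filter]
  exact Finset.sum_congr rfl fun k _ => by rw [indicator_apply]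

theorem memLp_sum_fiber {d : ℝ} {K : Finset ℤ} {Ω : Set ℝ} (hΩ : NullMeasurableSet Ω volume)
    {g : ℝ → ℂ} (hg : MemLp g 2 (volume.restrict Ω)) (μ : Measure ℝ) (hμ : μ ≤ volume) :
    MemLp (fun x => ∑ k ∈ fiber d K Ω x, g (x + (k : ℝ) / d)) 2 μ := by
  simp only [← sum_indicator_eq_sum_fiber]
  refine memLp_finsetSum _ fun k _ => ?_
  exact ((memLp_indicator_of_nullMeasurableSet hΩ hg).comp_measurePreserving
    (measurePreserving_add_right volume ((k : ℝ) / d))).mono_measure hμ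

theorem integral_eq_integral_fiber {d : ℝ} (hd : 0 < d) {S : Set ℝ} {K : Finset ℤ}
    (hS : NullMeasurableSet S volume) (hfin : volume S < ⊤)
    (hSK : S ⊆ Ico 0 (1 / d) + latticePoints d K) {g : ℝ → ℂ}
    (hg : MemLp g 2 (volume.restrict S)) :
    ∫ x in S, g x = ∫ x in Ico 0 (1 / d), ∑ k ∈ fiber d K S x, g (x + (k : ℝ) / d) := by
  have : IsFiniteMeasure (volume.restrict S) := ⟨by simpa using hfin⟩
  simp only [← sum_indicator_eq_sum_fiber]
  refine integral_eq_integral_sum_fiber hd hS hSK ?_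
  have : Integrable g (volume.restrict S) := hg.integrable (by norm_num)
  rw [← integrable_congr (indicator_ae_eq_of_ae_eq_set hS.toMeasurable_ae_eq),
    integrable_indicator_iff (measurableSet_toMeasurable _ _), IntegrableOn,
    Measure.restrict_congr_set hS.toMeasurable_ae_eq]
  exact this

/-! ### Spectra of fibers -/

/-- For `Λ` invariant under `d ℤ`, the exponentials with frequencies in `Λ` form, up to repetition
modulo `d`, an orthogonal basis of the functions on the finite set of all `k / d`, `k ∈ B`. -/
structure IsFiberSpectrum (d : ℝ) (B : Finset ℤ) (Λ : Set ℝ) : Prop where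
  nonempty : B.Nonempty
  orthogonal : ∀ l ∈ Λ, ∀ m ∈ Λ, (∀ n : ℤ, m - l ≠ n * d) →
    ∑ k ∈ B, planeWave ((m - l) * ((k : ℝ) / d)) = 0
  complete : ∀ w : ℤ → ℂ, (∀ l ∈ Λ, ∑ k ∈ B, planeWave (-(l * ((k : ℝ) / d))) * w k = 0) →
    ∀ k ∈ B, w k = 0

/-- The points of `[0, 1/d)` whose fiber is `B`. -/
def fiberLevel (d : ℝ) (K : Finset ℤ) (Ω : Set ℝ) (B : Finset ℤ) : Set ℝ :=
  {x ∈ Ico 0 (1 / d) | fiber d K Ω x = B}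

theorem nullMeasurableSet_fiberLevel {d : ℝ} {K : Finset ℤ} {Ω : Set ℝ}
    (hΩ : NullMeasurableSet Ω volume) (B : Finset ℤ) :
    NullMeasurableSet (fiberLevel d K Ω B) volume := by
  have : fiberLevel d K Ω B = Ico 0 (1 / d) ∩
      ⋂ k : ℤ, {x | k ∈ K ∧ x + (k : ℝ) / d ∈ Ω ↔ k ∈ B} := by
    ext x
    simp [fiberLevel, Finset.ext_iff, mem_fiber]
  rw [this]
  refine nullMeasurableSet_Ico.inter (NullMeasurableSet.iInter fun k => ?_)
  have hk : NullMeasurableSet {x : ℝ | x + (k : ℝ) / d ∈ Ω} volume :=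
    nullMeasurableSet_preimage_add hΩ _
  by_cases h1 : k ∈ K <;> by_cases h2 : k ∈ B <;> simp [h1, h2, hk]
  exact hk.compl

theorem integral_planeWave_Ico {d : ℝ} (hd : 0 < d) {n : ℤ} (hn : n ≠ 0) :
    ∫ x in Ico 0 (1 / d), planeWave (n * d * x) = 0 := by
  have hc : 2 * Real.pi * Complex.I * n * d ≠ 0 := by
    simp [Real.pi_ne_zero, hn, hd.ne']
  rw [Measure.restrict_congr_set (Ico_ae_eq_Ioc (μ := volume) (a := (0 : ℝ)) (b := 1 / d)),
    ← intervalIntegral.integral_of_le (by positivity)]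
  have : ∀ x : ℝ, planeWave (n * d * x) = Complex.exp (2 * Real.pi * Complex.I * n * d * x) := by
    intro x
    rw [planeWave]
    congr 1
    push_cast
    ring
  simp only [this]
  rw [integral_exp_mul_complex hc, ← this, ← this, show n * d * (1 / d) = n by field_simp]
  simp

theorem ae_forall_sub_of_ae {d : ℝ} {P : ℝ → Prop}
    (h : ∀ᵐ x ∂volume.restrict (Ico 0 (1 / d)), P x) :
    ∀ᵐ y : ℝ, ∀ k : ℤ, y - (k : ℝ) / d ∈ Ico 0 (1 / d) → P (y - (k : ℝ) / d) := by
  rw [ae_restrict_iff' measurableSet_Ico] at h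
  exact ae_all_iff.2 fun k =>
    (measurePreserving_sub_right volume ((k : ℝ) / d)).quasiMeasurePreserving.ae h

theorem ae_forall_add_of_ae {d : ℝ} {P : ℝ → Prop} (h : ∀ᵐ y : ℝ, P y) :
    ∀ᵐ x : ℝ, ∀ k : ℤ, P (x + (k : ℝ) / d) :=
  ae_all_iff.2 fun k =>
    (measurePreserving_add_right volume ((k : ℝ) / d)).quasiMeasurePreserving.ae h

theorem exists_mem_of_ae {E : Set ℝ} (hE : 0 < volume E) {P : ℝ → Prop} (h : ∀ᵐ x : ℝ, P x) :
    ∃ x ∈ E, P x := by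
  by_contra! hc
  exact hE.ne' (measure_mono_null (fun x hx => hc x hx) h)

theorem exists_mem_fiberLevel_of_ae {d : ℝ} {K : Finset ℤ} {Ω : Set ℝ} {B : Finset ℤ}
    (hB : 0 < volume (fiberLevel d K Ω B)) {P : ℝ → Prop}
    (h : ∀ᵐ x ∂volume.restrict (Ico 0 (1 / d)), P x) :
    ∃ x ∈ Ico 0 (1 / d), fiber d K Ω x = B ∧ P x := by
  rw [ae_restrict_iff' measurableSet_Ico] at h
  obtain ⟨x, hx, hP⟩ := exists_mem_of_ae hB h
  exact ⟨x, hx.1, hx.2, hP hx.1⟩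

theorem memLp_planeWave_mul {μ : Measure ℝ} {f : ℝ → ℂ} (hf : MemLp f 2 μ) (l : ℝ) :
    MemLp (fun x => planeWave (l * x) * f x) 2 μ := by
  refine hf.congr_norm ?_ (ae_of_all _ fun x => by simp)
  exact AEStronglyMeasurable.mul (by fun_prop) hf.1

theorem planeWave_int_mul_mul_div {d : ℝ} (hd : 0 < d) (n k : ℤ) :
    planeWave (n * d * ((k : ℝ) / d)) = 1 := by
  rw [show n * d * ((k : ℝ) / d) = ((n * k : ℤ) : ℝ) by push_cast; field_simp, planeWave_intCast]

/-- If `f` on `Ω` has vanishing Fourier transform along `c + d ℤ`, almost every fiber sum of the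
accordingly modulated function vanishes. -/
theorem sum_fiber_ae_eq_zero {d : ℝ} (hd : 0 < d) {K : Finset ℤ} {Ω : Set ℝ}
    (hΩ : NullMeasurableSet Ω volume) (hfin : volume Ω < ⊤)
    (hΩK : Ω ⊆ Ico 0 (1 / d) + latticePoints d K) {f : ℝ → ℂ}
    (hf : MemLp f 2 (volume.restrict Ω))
    (h0 : ∀ n : ℤ, ∫ x in Ω, planeWave (n * d * x) * f x = 0) :
    ∀ᵐ x ∂volume.restrict (Ico 0 (1 / d)), ∑ k ∈ fiber d K Ω x, f (x + (k : ℝ) / d) = 0 := by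
  refine ae_eq_zero_of_fourier_eq_zero hd
    (memLp_sum_fiber hΩ hf _ Measure.restrict_le_self) fun n => ?_
  rw [← h0 n, integral_eq_integral_fiber hd hΩ hfin hΩK (memLp_planeWave_mul hf _)]
  refine integral_congr_ae (ae_of_all _ fun x => ?_)
  -- The character of frequency `n d` has period `1/d`, so it factors out of the fiber sum.
  simp only [Finset.mul_sum, mul_add, planeWave_add, planeWave_int_mul_mul_div hd, mul_one]

theorem fiber_add_latticePoints {d : ℝ} (hd : 0 < d) (B : Finset ℤ) {x : ℝ}
    (hx : x ∈ Ico 0 (1 / d)) : fiber d B (Ico 0 (1 / d) + latticePoints d B) x = B := by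
  ext k
  rw [mem_fiber, mem_add_latticePoints hd subset_rfl hx]
  tauto

theorem IsFiberSpectrum.isSpectralPair {d : ℝ} (hd : 0 < d) {B : Finset ℤ} {Λ : Set ℝ}
    (hB : IsFiberSpectrum d B Λ) (hΛ : Λ.Countable) (hper : ∀ l ∈ Λ, ∀ n : ℤ, l + n * d ∈ Λ) :
    IsSpectralPair (Ico 0 (1 / d) + latticePoints d B) Λ := by
  set S := Ico 0 (1 / d) + latticePoints d B with hS
  have hSm : NullMeasurableSet S volume :=
    nullMeasurableSet_add_latticePoints nullMeasurableSet_Ico B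
  have hpos : 0 < volume S := by
    obtain ⟨k, hk⟩ := hB.nonempty
    have h1 : (fun x => x + (k : ℝ) / d) '' Ico 0 (1 / d) ⊆ S := by
      rintro _ ⟨x, hx, rfl⟩
      exact ⟨x, hx, _, ⟨k, hk, rfl⟩, rfl⟩
    refine lt_of_lt_of_le ?_ (measure_mono h1)
    simp [hd]
  have hfin : volume S < ⊤ := by
    rw [hS, add_latticePoints_eq]
    refine (measure_biUnion_finset_le _ _).trans_lt (ENNReal.sum_lt_top.2 fun k _ => ?_)
    have := (measurePreserving_sub_right volume ((k : ℝ) / d)).measure_preimage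
      (nullMeasurableSet_Ico (a := 0) (b := 1 / d))
    rw [this]
    simp
  have : IsFiniteMeasure (volume.restrict S) := ⟨by simpa using hfin⟩
  refine isSpectralPair_iff.2 ⟨hSm, hpos, hfin, fun l hl m hm hlm => ?_, fun f hf h0 => ?_⟩
  · have hL : MemLp (fun x => planeWave ((m - l) * x)) 2 (volume.restrict S) := by
      simpa using memLp_mul_planeWave (μ := volume.restrict S) 1 (m - l)
    rw [integral_eq_integral_fiber hd hSm hfin subset_rfl hL]
    have h1 : ∫ x in Ico 0 (1 / d), ∑ k ∈ fiber d B S x, planeWave ((m - l) * (x + (k : ℝ) / d)) =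
        ∫ x in Ico 0 (1 / d),
          planeWave ((m - l) * x) * ∑ k ∈ B, planeWave ((m - l) * ((k : ℝ) / d)) := by
      refine setIntegral_congr_fun measurableSet_Ico fun x hx => ?_
      simp only [fiber_add_latticePoints hd B hx, S, mul_add, planeWave_add, Finset.mul_sum]
    rw [h1, integral_mul_const]
    -- Frequencies congruent modulo `d` are orthogonal through the integral over the cell, all
    -- others through the sum over `B`.
    by_cases h : ∃ n : ℤ, m - l = n * d
    · obtain ⟨n, hn⟩ := h
      have hn0 : n ≠ 0 := by
        rintro rfl
        apply hlm
        simp only [Int.cast_zero, zero_mul] at hn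
        linarith
      rw [hn, integral_planeWave_Ico hd hn0, zero_mul]
    · rw [hB.orthogonal l hl m hm (by simpa using h), mul_zero]
  · have h1 : ∀ᵐ x ∂volume.restrict (Ico 0 (1 / d)), ∀ l ∈ Λ,
        ∑ k ∈ fiber d B S x, planeWave (-l * (x + (k : ℝ) / d)) * f (x + (k : ℝ) / d) = 0 := by
      -- Countability of `Λ` allows one null set to serve all frequencies at once.
      refine (ae_ball_iff hΛ).2 fun l hl => ?_
      refine sum_fiber_ae_eq_zero (f := fun x => planeWave (-l * x) * f x) hd hSm hfin subset_rfl
        (memLp_planeWave_mul hf _) fun n => ?_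
      rw [← h0 _ (hper l hl (-n))]
      refine integral_congr_ae (ae_of_all _ fun x => ?_)
      simp only [← mul_assoc, ← planeWave_add]
      congr 2
      push_cast
      ring
    have h2 : ∀ᵐ x ∂volume.restrict (Ico 0 (1 / d)), ∀ k ∈ B, f (x + (k : ℝ) / d) = 0 := by
      filter_upwards [h1, ae_restrict_mem measurableSet_Ico] with x hx hxI
      refine hB.complete (fun k => f (x + (k : ℝ) / d)) fun l hl => ?_
      have := hx l hl
      simp only [fiber_add_latticePoints hd B hxI, S, mul_add, planeWave_add, mul_assoc,
        ← Finset.mul_sum] at this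
      simpa [planeWave_ne_zero] using this
    filter_upwards [ae_restrict_of_ae (ae_forall_sub_of_ae h2), ae_restrict_mem₀ hSm] with y hy hyS
    obtain ⟨x, hx, _, ⟨k, hk, rfl⟩, rfl⟩ := hyS
    simpa using hy k (by simpa using hx) k hk

theorem IsSpectralPair.isFiberSpectrum {d : ℝ} (hd : 0 < d) {K : Finset ℤ} {Ω Λ : Set ℝ}
    (h : IsSpectralPair Ω Λ) (hΩK : Ω ⊆ Ico 0 (1 / d) + latticePoints d K)
    (hper : ∀ l ∈ Λ, ∀ n : ℤ, l + n * d ∈ Λ) {B : Finset ℤ}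
    (hB : 0 < volume (fiberLevel d K Ω B)) : IsFiberSpectrum d B Λ := by
  obtain ⟨hΩ, hpos, hfin, horth, hcomp⟩ := isSpectralPair_iff.1 h
  have : IsFiniteMeasure (volume.restrict Ω) := ⟨by simpa using hfin⟩
  have hw : ∀ l : ℝ, MemLp (fun x => planeWave (l * x)) 2 (volume.restrict Ω) := fun l => by
    simpa using memLp_mul_planeWave (μ := volume.restrict Ω) 1 l
  have hp : 0 < (volume Ω).toReal := ENNReal.toReal_pos hpos.ne' hfin.ne
  refine ⟨?_, fun l hl m hm hlm => ?_, fun w hw0 => ?_⟩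
  -- If `Λ` were empty, the constant `1` would contradict totality.
  · obtain ⟨l, hl⟩ : Λ.Nonempty := by
      by_contra hne
      rw [not_nonempty_iff_eq_empty] at hne
      have := hcomp (fun _ => 1) (memLp_const _) (by simp [hne])
      rw [Filter.EventuallyEq, ae_restrict_iff'₀ hΩ] at this
      obtain ⟨x, hx, hx'⟩ := exists_mem_of_ae hpos this
      simpa using hx' hx
    have hz : ∀ n : ℤ, n ≠ 0 → ∫ x in Ω, planeWave (n * d * x) = 0 := by
      intro n hn
      rw [← horth l hl _ (hper l hl n) (by simp [hn, hd.ne'])]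
      congr 1
      ext x
      ring_nf
    -- Orthogonality of `l` and `l + n d` kills the nonzero Fourier coefficients of the fiber
    -- cardinality. It is therefore almost everywhere its mean `d |Ω|`, which is positive, so an
    -- empty fiber occurs only on a null set.
    have hcount := ae_eq_zero_of_fourier_eq_zero hd
      (h := fun x => (∑ k ∈ fiber d K Ω x, (1 : ℂ)) - d * (volume Ω).toReal)
      ((memLp_sum_fiber hΩ (memLp_const 1) _ Measure.restrict_le_self).sub (memLp_const _)) ?_
    · obtain ⟨x, _, hxB, hx⟩ := exists_mem_fiberLevel_of_ae hB hcount
      rw [Finset.nonempty_iff_ne_empty]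
      rintro rfl
      have hx0 : (∑ k ∈ fiber d K Ω x, (1 : ℂ)) - d * (volume Ω).toReal = 0 := hx
      rw [hxB, Finset.sum_empty, zero_sub, neg_eq_zero] at hx0
      exact mul_ne_zero (by exact_mod_cast hd.ne') (by exact_mod_cast hp.ne') hx0
    · intro n
      have h1 := integral_eq_integral_fiber hd hΩ hfin hΩK (hw (n * d))
      simp only [mul_add, planeWave_add, planeWave_int_mul_mul_div hd, mul_one] at h1
      have h2 : ∫ x in Ico 0 (1 / d), planeWave (n * d * x) *
            ((∑ k ∈ fiber d K Ω x, (1 : ℂ)) - d * (volume Ω).toReal) =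
          (∫ x in Ω, planeWave (n * d * x)) -
            (∫ x in Ico 0 (1 / d), planeWave (n * d * x)) * (d * (volume Ω).toReal) := by
        rw [h1, ← integral_mul_const, ← integral_sub]
        · refine integral_congr_ae (ae_of_all _ fun x => ?_)
          simp only [mul_sub, Finset.mul_sum, mul_one]
        · have := (memLp_sum_fiber (d := d) (K := K) hΩ (hw (n * d))
            (volume.restrict (Ico 0 (1 / d))) Measure.restrict_le_self).integrable (by norm_num)
          simpa only [mul_add, planeWave_add, planeWave_int_mul_mul_div hd, mul_one] using this
        · refine Integrable.mul_const ?_ _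
          have := (memLp_mul_planeWave (μ := volume.restrict (Ico 0 (1 / d))) 1
            (n * d)).integrable (by norm_num)
          simpa using this
      rw [h2]
      rcases eq_or_ne n 0 with rfl | hn
      · have hdc : (d : ℂ) ≠ 0 := by exact_mod_cast hd.ne'
        simp [Measure.real, hd.le]
        field_simp
        simp
      · rw [hz n hn, integral_planeWave_Ico hd hn]
        simp
  · have h1 := sum_fiber_ae_eq_zero hd hΩ hfin hΩK (hw (m - l)) fun n => ?_
    · obtain ⟨x, _, hxB, hx⟩ := exists_mem_fiberLevel_of_ae hB h1
      simp only [hxB, mul_add, planeWave_add, ← Finset.mul_sum] at hx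
      simpa [planeWave_ne_zero] using hx
    · rw [← horth l hl _ (hper m hm n) ?_]
      · congr 1
        ext x
        rw [← planeWave_add]
        ring_nf
      · intro he
        apply hlm (-n)
        push_cast
        linarith
  · set E := fiberLevel d K Ω B with hE
    have hEI : E ⊆ Ico 0 (1 / d) := fun x hx => hx.1
    have hEm : NullMeasurableSet E volume := nullMeasurableSet_fiberLevel hΩ B
    -- Test function equal to `w k` on `E + k/d`. Its fiber sums against the characters vanish by
    -- the assumption on `w`, so totality forces `f = 0` almost everywhere on `Ω`.
    let f : ℝ → ℂ := fun y => ∑ k ∈ B, E.indicator (fun _ => w k) (y - (k : ℝ) / d)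
    have hf : MemLp f 2 volume := by
      refine memLp_finsetSum _ fun k _ => ?_
      have hEf : IsFiniteMeasure (volume.restrict E) :=
        ⟨by simpa using (measure_mono hEI).trans_lt (by simp)⟩
      exact (memLp_indicator_of_nullMeasurableSet hEm (memLp_const (w k))).comp_measurePreserving
        (measurePreserving_sub_right volume ((k : ℝ) / d))
    have hfE : ∀ x ∈ E, ∀ j ∈ B, f (x + (j : ℝ) / d) = w j := by
      intro x hx j hj
      simp only [f]
      rw [Finset.sum_eq_single_of_mem j hj]
      · simp [hx]
      · intro k _ hkj
        refine indicator_of_notMem (fun hk => hkj ?_) _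
        exact int_eq_of_mem_Ico hd (hEI hk) (hEI hx) (by ring)
    have hfN : ∀ x ∈ Ico 0 (1 / d), x ∉ E → ∀ j : ℤ, f (x + (j : ℝ) / d) = 0 := by
      intro x hx hxE j
      refine Finset.sum_eq_zero fun k _ => indicator_of_notMem (fun hk => hxE ?_) _
      obtain rfl := int_eq_of_mem_Ico hd (hEI hk) hx (k := k) (j := j) (by ring)
      simpa using hk
    have hf0 := hcomp f (hf.restrict Ω) fun l hl => ?_
    · rw [Filter.EventuallyEq, ae_restrict_iff'₀ hΩ] at hf0
      -- A point of `E` all of whose lattice translates avoid the exceptional null set.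
      obtain ⟨x, hx, hxP⟩ := exists_mem_of_ae hB (ae_forall_add_of_ae (d := d) hf0)
      intro k hk
      rw [← hfE x hx k hk]
      refine hxP k ?_
      have hx2 := hx.2
      rw [← hx2, mem_fiber] at hk
      exact hk.2
    · have h1 := integral_eq_integral_fiber hd hΩ hfin hΩK
        (memLp_planeWave_mul (hf.restrict Ω) (-l))
      simp only [← neg_mul]
      rw [h1]
      refine setIntegral_eq_zero_of_forall_eq_zero fun x hx => ?_
      by_cases hxE : x ∈ E
      · rw [hxE.2]
        have h2 : ∀ k ∈ B, planeWave (-l * (x + (k : ℝ) / d)) * f (x + (k : ℝ) / d) =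
            planeWave (-l * x) * (planeWave (-(l * ((k : ℝ) / d))) * w k) := by
          intro k hk
          rw [hfE x hxE k hk, mul_add, planeWave_add, neg_mul l ((k : ℝ) / d), mul_assoc]
        rw [Finset.sum_congr rfl h2, ← Finset.mul_sum, hw0 l hl, mul_zero]
      · exact Finset.sum_eq_zero fun k _ => by rw [hfN x hx hxE, mul_zero]

/-! ### Bounded sets and half-open unions -/

theorem exists_subset_Ico_add_latticePoints {d : ℝ} (hd : 0 < d) {Ω : Set ℝ}
    (hΩ : Bornology.IsBounded Ω) :
    ∃ K : Finset ℤ, Ω ⊆ Ico 0 (1 / d) + latticePoints d K := by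
  obtain ⟨R, hR⟩ := isBounded_iff_forall_norm_le.1 hΩ
  refine ⟨Finset.Icc ⌊-R * d⌋ ⌊R * d⌋, fun y hy => ?_⟩
  have hy' := abs_le.1 (hR y hy)
  refine ⟨y - (⌊y * d⌋ : ℝ) / d, ⟨?_, ?_⟩, _, ⟨⌊y * d⌋, ?_, rfl⟩, by simp⟩
  · rw [sub_nonneg, div_le_iff₀ hd]
    exact Int.floor_le _
  · rw [sub_lt_iff_lt_add, ← add_div, lt_div_iff₀ hd, add_comm]
    exact Int.lt_floor_add_one _
  · rw [Finset.mem_coe, Finset.mem_Icc]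
    exact ⟨Int.floor_le_floor (mul_le_mul_of_nonneg_right hy'.1 hd.le),
      Int.floor_le_floor (mul_le_mul_of_nonneg_right hy'.2 hd.le)⟩

theorem IsHalfOpenUnion.eventually_mem_iff {Ω : Set ℝ} (hΩ : IsHalfOpenUnion Ω) (x : ℝ) :
    ∀ᶠ t in nhdsWithin x (Ici x), (t ∈ Ω ↔ x ∈ Ω) := by
  obtain ⟨n, a, b, rfl⟩ := hΩ
  have h : ∀ i, ∀ᶠ t in nhdsWithin x (Ici x), (t ∈ Ico (a i) (b i) ↔ x ∈ Ico (a i) (b i)) := by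
    intro i
    have hb : ∀ᶠ t in nhdsWithin x (Ici x), (t < b i ↔ x < b i) := by
      rcases lt_or_ge x (b i) with hx | hx
      · filter_upwards [mem_nhdsWithin_of_mem_nhds (Iio_mem_nhds hx)] with t ht
        exact iff_of_true ht hx
      · filter_upwards [self_mem_nhdsWithin] with t ht
        exact iff_of_false (hx.trans ht).not_gt hx.not_gt
    have ha : ∀ᶠ t in nhdsWithin x (Ici x), (a i ≤ t ↔ a i ≤ x) := by
      rcases lt_or_ge x (a i) with hx | hx
      · filter_upwards [mem_nhdsWithin_of_mem_nhds (Iio_mem_nhds hx)] with t ht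
        exact iff_of_false (not_le.2 ht) hx.not_ge
      · filter_upwards [self_mem_nhdsWithin] with t ht
        exact iff_of_true (hx.trans ht) hx
    filter_upwards [ha, hb] with t h1 h2
    rw [mem_Ico, mem_Ico, h1, h2]
  filter_upwards [Filter.eventually_all.2 h] with t ht
  simp only [mem_iUnion, ht]

/-- Membership in a half-open union is locally constant to the right, so a fiber that occurs at `x`
persists on some `[x, u)`. No exceptional fibers remain, which gives exact equality. -/
theorem IsHalfOpenUnion.volume_fiberLevel_pos {d : ℝ} {K : Finset ℤ} {Ω : Set ℝ}
    (hΩ : IsHalfOpenUnion Ω) {x : ℝ} (hx : x ∈ Ico 0 (1 / d)) :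
    0 < volume (fiberLevel d K Ω (fiber d K Ω x)) := by
  have h : ∀ᶠ t in nhdsWithin x (Ici x), t ∈ fiberLevel d K Ω (fiber d K Ω x) := by
    have h1 : ∀ k ∈ K, ∀ᶠ t in nhdsWithin x (Ici x), (t + (k : ℝ) / d ∈ Ω ↔ x + (k : ℝ) / d ∈ Ω) := by
      intro k _
      have ht : Filter.Tendsto (fun t => t + (k : ℝ) / d) (nhdsWithin x (Ici x))
          (nhdsWithin (x + (k : ℝ) / d) (Ici (x + (k : ℝ) / d))) := by
        refine tendsto_nhdsWithin_of_tendsto_nhds_of_eventually_within _ ?_ ?_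
        · exact ((continuous_add_const _).tendsto x).mono_left nhdsWithin_le_nhds
        · filter_upwards [self_mem_nhdsWithin] with t ht
          simpa using ht
      exact ht.eventually (hΩ.eventually_mem_iff _)
    filter_upwards [(Filter.eventually_all_finset K).2 h1, self_mem_nhdsWithin,
      mem_nhdsWithin_of_mem_nhds (Iio_mem_nhds hx.2)] with t h1 h2 h3
    refine ⟨⟨hx.1.trans h2, h3⟩, ?_⟩
    ext k
    simp only [mem_fiber]
    exact and_congr_right fun hk => h1 k hk
  obtain ⟨u, hu, hsub⟩ := mem_nhdsGE_iff_exists_Ico_subset.1 h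
  refine lt_of_lt_of_le ?_ (measure_mono hsub)
  simpa using hu

/-! ### Assembling the partition -/

theorem IsPeriodicSet.countable {d : ℝ} {Λ : Set ℝ} (h : IsPeriodicSet d Λ) : Λ.Countable := by
  obtain ⟨Γ, rfl⟩ := h
  rw [← image2_add]
  exact Γ.countable_toSet.image2 (countable_range _) _

theorem IsPeriodicSet.add_mem {d : ℝ} {Λ : Set ℝ} (h : IsPeriodicSet d Λ) {l : ℝ} (hl : l ∈ Λ)
    (n : ℤ) : l + n * d ∈ Λ := by
  obtain ⟨Γ, rfl⟩ := h
  obtain ⟨g, hg, _, ⟨k, rfl⟩, rfl⟩ := hl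
  exact ⟨g, hg, _, ⟨k + n, rfl⟩, by push_cast; ring⟩

theorem disjoint_fiberLevel {d : ℝ} {K : Finset ℤ} {Ω : Set ℝ} {B C : Finset ℤ} (h : B ≠ C) :
    Disjoint (fiberLevel d K Ω B) (fiberLevel d K Ω C) :=
  Set.disjoint_left.2 fun _ hx hx' => h (hx.2.symm.trans hx'.2)

theorem theorem2 (Ω Λ : Set ℝ) (d : ℝ) (hd : 0 < d)
    (hΩΛ : IsSpectralPair Ω Λ) (hΩ : Bornology.IsBounded Ω) (hΛ : IsPeriodicSet d Λ) :
    ∃ (k : ℕ) (E A : Fin k → Set ℝ),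
      (∀ j, NullMeasurableSet (E j) volume) ∧
      (∀ j, 0 < volume (E j)) ∧
      Pairwise (fun i j => Disjoint (E i) (E j)) ∧
      (⋃ j, E j) = Ico 0 (1 / d) ∧
      (∀ j, A j ⊆ range fun n : ℤ => (n : ℝ) / d) ∧
      Ω =ᵐ[volume] (⋃ j, (E j + A j) : Set ℝ) ∧
      (IsHalfOpenUnion Ω → Ω = ⋃ j, (E j + A j)) ∧
      ∀ j, IsSpectralPair (Ico 0 (1 / d) + A j) Λ := by
  classical
  obtain ⟨K, hK⟩ := exists_subset_Ico_add_latticePoints hd hΩ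
  have hΩm := hΩΛ.nullMeasurableSet
  set S : Finset (Finset ℤ) := K.powerset.filter fun B => 0 < volume (fiberLevel d K Ω B) with hS
  -- Points whose fiber occurs only on a null set; a finite union of null level sets.
  set R : Set ℝ := {x ∈ Ico 0 (1 / d) | fiber d K Ω x ∉ S} with hR
  have hfib : ∀ x, fiber d K Ω x ⊆ K := fun x k hk => (mem_fiber.1 hk).1
  have hR0 : volume R = 0 := by
    refine measure_mono_null (t := ⋃ B ∈ K.powerset \ S, fiberLevel d K Ω B) ?_ ?_
    · intro x hx
      simp only [mem_iUnion]
      exact ⟨fiber d K Ω x, by simp [hfib, hx.2], hx.1, rfl⟩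
    · refine (measure_biUnion_null_iff (Finset.countable_toSet _)).2 fun B hB => ?_
      simp only [hS, Finset.coe_sdiff, mem_sdiff, Finset.mem_coe, Finset.mem_filter, not_and,
        not_lt, nonpos_iff_eq_zero] at hB
      exact hB.2 hB.1
  obtain ⟨x₀, hx₀, hx₀R⟩ : ∃ x ∈ Ico 0 (1 / d), x ∉ R :=
    exists_mem_of_ae (by simpa using hd) (measure_eq_zero_iff_ae_notMem.1 hR0)
  have hB₀ : fiber d K Ω x₀ ∈ S := by
    by_contra h
    exact hx₀R ⟨hx₀, h⟩
  set B₀ := fiber d K Ω x₀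
  -- The pieces must cover the whole cell, so the null set `R` is attached to one of them, that of
  -- `B₀`.
  let F : Finset ℤ → Set ℝ := fun B => fiberLevel d K Ω B ∪ if B = B₀ then R else ∅
  have hFm : ∀ B, NullMeasurableSet (F B) volume := fun B => by
    refine (nullMeasurableSet_fiberLevel hΩm B).union ?_
    split_ifs
    exacts [NullMeasurableSet.of_null hR0, nullMeasurableSet_empty]
  have hFI : ∀ B, F B ⊆ Ico 0 (1 / d) := fun B => by
    refine union_subset (fun x hx => hx.1) ?_
    split_ifs
    exacts [fun x hx => hx.1, empty_subset _]
  have hFl : ∀ B, ∀ x ∉ R, x ∈ F B → x ∈ fiberLevel d K Ω B := by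
    intro B x hxR hx
    refine hx.resolve_right fun h => ?_
    split_ifs at h
    exacts [hxR h, h]
  have hRl : ∀ B ∈ S, Disjoint (fiberLevel d K Ω B) R := fun B hB =>
    Set.disjoint_left.2 fun x hx hx' => hx'.2 (hx.2 ▸ hB)
  -- Off the lattice translates of `R` the two sets agree pointwise. This serves both the almost
  -- everywhere equality and the exact one, where `R` is empty.
  have key : ∀ y : ℝ, (∀ k : ℤ, y - (k : ℝ) / d ∈ Ico 0 (1 / d) → y - (k : ℝ) / d ∉ R) →
      (y ∈ Ω ↔ y ∈ ⋃ j, (F (S.equivFin.symm j) + latticePoints d (S.equivFin.symm j) : Set ℝ)) := by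
    intro y hy
    simp only [mem_iUnion]
    constructor
    · intro hyΩ
      obtain ⟨x, hx, _, ⟨k, hk, rfl⟩, rfl⟩ := hK hyΩ
      have hxR : x ∉ R := by simpa using hy k (by simpa using hx)
      have hxS : fiber d K Ω x ∈ S := by
        by_contra h
        exact hxR ⟨hx, h⟩
      refine ⟨S.equivFin ⟨_, hxS⟩, x, ?_, _, ⟨k, ?_, rfl⟩, rfl⟩
      · rw [Equiv.symm_apply_apply]
        exact Or.inl ⟨hx, rfl⟩
      · rw [Equiv.symm_apply_apply, Finset.mem_coe, mem_fiber]
        exact ⟨hk, hyΩ⟩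
    · rintro ⟨j, x, hx, _, ⟨k, hk, rfl⟩, rfl⟩
      have hxR : x ∉ R := by simpa using hy k (by simpa using hFI _ hx)
      have := (hFl _ x hxR hx).2
      rw [Finset.mem_coe, ← this, mem_fiber] at hk
      exact hk.2
  refine ⟨S.card, fun j => F (S.equivFin.symm j), fun j => latticePoints d (S.equivFin.symm j),
    fun j => hFm _, fun j => ?_, fun i j hij => ?_, ?_, fun j => ?_, ?_, fun hho => ?_,
    fun j => ?_⟩
  · exact (Finset.mem_filter.1 (S.equivFin.symm j).2).2.trans_le (measure_mono subset_union_left)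
  · have hne : (S.equivFin.symm i : Finset ℤ) ≠ S.equivFin.symm j := fun h =>
      hij (S.equivFin.symm.injective (Subtype.ext h))
    have h1 := hRl _ (S.equivFin.symm i).2
    have h2 := hRl _ (S.equivFin.symm j).2
    have h3 := disjoint_fiberLevel (d := d) (K := K) (Ω := Ω) hne
    simp only [F, disjoint_union_left, disjoint_union_right]
    refine ⟨⟨h3, ?_⟩, ?_, ?_⟩
    · split_ifs
      exacts [h2.symm, by simp]
    · split_ifs
      exacts [h1, by simp]
    · split_ifs with h4 h5
      exacts [absurd (h4.trans h5.symm) (by assumption), by simp, by simp, by simp]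
  · refine subset_antisymm (iUnion_subset fun j => hFI _) fun x hx => ?_
    rw [mem_iUnion]
    by_cases hxS : fiber d K Ω x ∈ S
    · refine ⟨S.equivFin ⟨_, hxS⟩, ?_⟩
      rw [Equiv.symm_apply_apply]
      exact Or.inl ⟨hx, rfl⟩
    · refine ⟨S.equivFin ⟨_, hB₀⟩, ?_⟩
      rw [Equiv.symm_apply_apply]
      refine Or.inr ?_
      rw [if_pos rfl]
      exact ⟨hx, hxS⟩
  · rintro _ ⟨k, _, rfl⟩
    exact ⟨k, rfl⟩
  · rw [Filter.eventuallyEq_set]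
    filter_upwards [ae_forall_sub_of_ae (d := d) (P := fun x => x ∉ R)
      (ae_restrict_of_ae (measure_eq_zero_iff_ae_notMem.1 hR0))] with y hy
    exact key y hy
  · ext y
    refine key y fun k hk hkR => hkR.2 ?_
    rw [hS, Finset.mem_filter, Finset.mem_powerset]
    exact ⟨hfib _, hho.volume_fiberLevel_pos hk⟩
  · refine IsFiberSpectrum.isSpectralPair hd ?_ hΛ.countable fun l hl n => hΛ.add_mem hl n
    exact hΩΛ.isFiberSpectrum hd hK (fun l hl n => hΛ.add_mem hl n)
      (Finset.mem_filter.1 (S.equivFin.symm j).2).2
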